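/- All Banach spaces are real. Let $X$ be a metric space with a distinguished point $0$. For a Banach space $E$, let $Lip_0(X;E)$ be the Banach space of all Lipschitz maps $T:X\to E$ with $T(0)=0$, normed by the Lipschitz constant $Lip(T)=\sup_{x\ne y}\|T(x)-T(y)\|/d(x,y)$. Put $X^{\#}=Lip_0(X;\mathbb R)$, and let $\delta_{(x,y)}\in (X^{\#})^*$ be the functional $\delta_{(x,y)}(f)=f(x)-f(y)$. The free Banach space $\mathcal F(X)$ is the closed linear span of $\{\delta_{(x,y)}:x,y\in X\}$ in $(X^{\#})^*$. Let $1\le p<\infty$ and $\frac1p+\frac1{p^*}=1$. For Banach spaces $F,G$ and $z\in F\otimes G$ put $$d_p(z)=\inf\Big\{\sup_{\varphi\in F^*,\ \|\varphi\|\le 1}\Big(\sum_{i=1}^n|\varphi(x_i)|^p\Big)^{1/p}\cdot\Big(\sum_{i=1}^n\|g_i\|^{p^*}\Big)^{1/p^*}\ :\ z=\sum_{i=1}^n x_i\otimes g_i\Big\}$$ (with $\max_i\|g_i\|$ as the second factor if $p=1$). A map $T\in Lip_0(X;E)$ is strictly Lipschitz $p$-summing if there is a constant $C\ge 0$ such that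 for all $n$, all $x_1,\dots,x_n,y_1,\dots,y_n\in X$ and all $e_1^*,\dots,e_n^*\in E^*$ $$\Big|\sum_{i=1}^n\langle T(x_i)-T(y_i),e_i^*\rangle\Big|\le C\,d_p\Big(\sum_{i=1}^n\delta_{(x_i,y_i)}\otimes e_i^*\Big),$$ the norm $d_p$ being taken in $\mathcal F(X)\otimes E^*$. The space of these maps is $\Pi_p^{SL}(X;E)$, and $\|T\|_{\Pi_p^{SL}}$ is the smallest such $C$. A map $T\in Lip_0(X;E)$ is strongly Lipschitz $p$-integral if there are a probability space $(\Omega,\Sigma,\mu)$, a map $b\in Lip_0(X;L_\infty(\mu))$ and a bounded linear operator $A:L_p(\mu)\to E^{**}$ such that $K_E\circ T=A\circ I_{\infty,p}\circ b$, where $K_E:E\to E^{**}$ is the canonical embedding and $I_{\infty,p}:L_\infty(\mu)\to L_p(\mu)$ is the formal inclusion. The space of these maps is $\mathfrak I_p^{SL}(X;E)$, normed by $\mathrm{si}_p^L(T)=\inf Lip(b)\,\|A\|$, the infimum being over all such factorizations. A Banach space $E$ is injective if for every Banach space $F$ and every closed subspace $G\subseteq F$, each bounded linear operator $w:G\to E$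 has a bounded linear extension $W:F\to E$ with $\|W\|=\|w\|$. **Corollary 3.9.** Let $1\le p<\infty$, let $X$ be a pointed metric space and let $E$ be an injective Banach space. Then $$\Pi_p^{SL}(X;E)=\mathfrak I_p^{SL}(X;E)\qquad\text{with}\qquad \|T\|_{\Pi_p^{SL}}=\mathrm{si}_p^L(T)\ \text{ for every } T \text{ in this space}.$$ -/

import Mathlib

open MeasureTheory
open scoped ENNReal NNReal TensorProduct

set_option maxSynthPendingDepth 3

universe u v

noncomputable section

namespace LipIdeal

/-! ### Lipschitz maps vanishing at the base point -/

section Lip0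

variable {X : Type v} [MetricSpace X]

/-- The linear space of all Lipschitz maps `X → E` vanishing at the base point `x₀`. -/
def lip0Submodule (x₀ : X) (E : Type u) [NormedAddCommGroup E] [NormedSpace ℝ E] :
    Submodule ℝ (X → E) where
  carrier := {f | f x₀ = 0 ∧ ∃ K : ℝ≥0, LipschitzWith K f}
  zero_mem' := ⟨rfl, 0, LipschitzWith.const 0⟩
  add_mem' := by
    rintro f g ⟨hf, K, hK⟩ ⟨hg, L, hL⟩
    exact ⟨by simp [hf, hg], K + L, hK.add hL⟩
  smul_mem' := by
    rintro c f ⟨hf, K, hK⟩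
    refine ⟨by simp [hf], ‖c‖₊ * K, LipschitzWith.of_dist_le_mul fun x y => ?_⟩
    have h := hK.dist_le_mul x y
    rw [Pi.smul_apply, Pi.smul_apply, dist_smul₀]
    push_cast
    rw [mul_assoc]
    exact mul_le_mul_of_nonneg_left h (norm_nonneg c)

/-- `Lip0 x₀ E` is the space `Lip₀(X; E)` of Lipschitz maps `X → E` vanishing at the base
point `x₀`. It is a type synonym of its own, so that its topology is that of the Lipschitz norm
below (and not the topology of pointwise convergence). -/
def Lip0 (x₀ : X) (E : Type u) [NormedAddCommGroup E] [NormedSpace ℝ E] : Type (max u v) :=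
  lip0Submodule x₀ E

variable {x₀ : X} {E : Type u} [NormedAddCommGroup E] [NormedSpace ℝ E]

instance : AddCommGroup (Lip0 x₀ E) := inferInstanceAs (AddCommGroup (lip0Submodule x₀ E))

instance : Module ℝ (Lip0 x₀ E) := inferInstanceAs (Module ℝ (lip0Submodule x₀ E))

instance : FunLike (Lip0 x₀ E) X E where
  coe f := f.1
  coe_injective _ _ h := Subtype.ext h

/-- Constructor of elements of `Lip₀(X; E)`. -/
def Lip0.mk (f : X → E) (h₀ : f x₀ = 0) (hf : ∃ K : ℝ≥0, LipschitzWith K f) : Lip0 x₀ E :=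
  ⟨f, h₀, hf⟩

/-- The Lipschitz norm `Lip(f) = sup {‖f x - f y‖ / d(x, y) : x ≠ y}`. (The pairs with `x = y`
contribute the value `0 / 0 = 0` and so do not change the supremum.) -/
instance : Norm (Lip0 x₀ E) := ⟨fun f => ⨆ q : X × X, ‖f q.1 - f q.2‖ / dist q.1 q.2⟩

theorem Lip0.ext {f g : Lip0 x₀ E} (h : ∀ x, f x = g x) : f = g := DFunLike.ext f g h

@[simp]
theorem Lip0.mk_apply (f : X → E) (h₀ : f x₀ = 0) (hf : ∃ K : ℝ≥0, LipschitzWith K f) (x : X) :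
    (Lip0.mk f h₀ hf : Lip0 x₀ E) x = f x := rfl

theorem Lip0.exists_lipschitzWith (f : Lip0 x₀ E) : ∃ K : ℝ≥0, LipschitzWith K f := f.2.2

theorem Lip0.apply_base (f : Lip0 x₀ E) : f x₀ = 0 := f.2.1

theorem Lip0.add_apply (f g : Lip0 x₀ E) (x : X) : (f + g) x = f x + g x := rfl

theorem Lip0.smul_apply (c : ℝ) (f : Lip0 x₀ E) (x : X) : (c • f) x = c • f x := rfl

theorem Lip0.norm_def (f : Lip0 x₀ E) :
    ‖f‖ = ⨆ q : X × X, ‖f q.1 - f q.2‖ / dist q.1 q.2 := rfl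

theorem Lip0.norm_nonneg' (f : Lip0 x₀ E) : 0 ≤ ‖f‖ :=
  Real.iSup_nonneg fun _ => div_nonneg (norm_nonneg _) dist_nonneg

theorem Lip0.norm_sub_le (f : Lip0 x₀ E) (x y : X) : ‖f x - f y‖ ≤ ‖f‖ * dist x y := by
  obtain ⟨K, hK⟩ := f.exists_lipschitzWith
  have hbdd : BddAbove (Set.range fun q : X × X => ‖f q.1 - f q.2‖ / dist q.1 q.2) := by
    refine ⟨K, ?_⟩
    rintro _ ⟨q, rfl⟩
    refine div_le_of_le_mul₀ dist_nonneg K.2 ?_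
    rw [← dist_eq_norm]
    exact hK.dist_le_mul q.1 q.2
  rcases eq_or_ne x y with rfl | hxy
  · simp
  · have h := le_ciSup hbdd (x, y)
    exact (div_le_iff₀ (dist_pos.2 hxy)).1 h

theorem Lip0.norm_le {f : Lip0 x₀ E} {C : ℝ} (hC : 0 ≤ C)
    (h : ∀ x y, ‖f x - f y‖ ≤ C * dist x y) : ‖f‖ ≤ C :=
  Real.iSup_le (fun q => div_le_of_le_mul₀ dist_nonneg hC (h q.1 q.2)) hC

theorem Lip0.core : NormedSpace.Core ℝ (Lip0 x₀ E) where
  norm_nonneg := Lip0.norm_nonneg'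
  norm_smul c f := by
    rw [Lip0.norm_def, Lip0.norm_def, Real.mul_iSup_of_nonneg (norm_nonneg c)]
    refine iSup_congr fun q => ?_
    rw [Lip0.smul_apply, Lip0.smul_apply, ← smul_sub, norm_smul, mul_div_assoc]
  norm_triangle f g := by
    refine Lip0.norm_le (add_nonneg f.norm_nonneg' g.norm_nonneg') fun x y => ?_
    rw [Lip0.add_apply, Lip0.add_apply, add_sub_add_comm, add_mul]
    exact (norm_add_le _ _).trans (add_le_add (f.norm_sub_le x y) (g.norm_sub_le x y))
  norm_eq_zero_iff f := by
    constructor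
    · intro h
      refine Lip0.ext fun x => ?_
      have h1 := f.norm_sub_le x x₀
      rw [h, zero_mul, f.apply_base, sub_zero] at h1
      exact norm_le_zero_iff.1 h1
    · rintro rfl
      refine le_antisymm (Lip0.norm_le le_rfl fun x y => ?_) (Lip0.norm_nonneg' _)
      change ‖(0 : E) - 0‖ ≤ 0 * dist x y
      simp

instance : NormedAddCommGroup (Lip0 x₀ E) := NormedAddCommGroup.ofCore Lip0.core

instance : NormedSpace ℝ (Lip0 x₀ E) := NormedSpace.ofCore Lip0.core

end Lip0

/-! ### The free Banach space -/

section Free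

variable {X : Type v} [MetricSpace X]

/-- The functional `δ_(x,y) : X^# → ℝ`, `f ↦ f x - f y`, where `X^# = Lip₀(X; ℝ)`. -/
def evalDiff (x₀ x y : X) : StrongDual ℝ (Lip0 x₀ ℝ) :=
  LinearMap.mkContinuous
    { toFun := fun f => f x - f y
      map_add' := fun f g => by rw [Lip0.add_apply, Lip0.add_apply]; ring
      map_smul' := fun c f => by
        rw [Lip0.smul_apply, Lip0.smul_apply, ← smul_sub, RingHom.id_apply] }
    (dist x y)
    (fun f => by
      rw [mul_comm]
      exact f.norm_sub_le x y)

/-- The free Banach space `𝓕(X)` (Lipschitz-free space, Arens–Eells space): the closed linear span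
of the functionals `δ_(x,y)` in the dual of the Banach space `X^#`. -/
def FreeBanach (x₀ : X) : Submodule ℝ (StrongDual ℝ (Lip0 x₀ ℝ)) :=
  (Submodule.span ℝ (Set.range fun q : X × X => evalDiff x₀ q.1 q.2)).topologicalClosure

/-- The element `δ_(x,y)` of the free Banach space. -/
def delta (x₀ x y : X) : FreeBanach x₀ :=
  ⟨evalDiff x₀ x y, Submodule.le_topologicalClosure _ (Submodule.subset_span ⟨(x, y), rfl⟩)⟩

end Free

/-! ### The Chevet–Saphar norm -/

section ChevetSaphar

variable {F : Type*} [NormedAddCommGroup F] [NormedSpace ℝ F]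
  {G : Type*} [NormedAddCommGroup G] [NormedSpace ℝ G]

/-- The norm of `l_p^n(G)`: `(∑ ‖gᵢ‖ ^ p) ^ (1 / p)`, and `max ‖gᵢ‖` for `p = ∞`. -/
def strongNorm (p : ℝ≥0∞) {n : ℕ} (g : Fin n → G) : ℝ :=
  ‖(WithLp.toLp p g : PiLp p fun _ : Fin n => G)‖

/-- The norm of `l_p^{n,w}(F)`: the supremum over the dual unit ball of the `l_p^n`-norms of
`(φ(xᵢ))ᵢ`. -/
def weakNorm (p : ℝ≥0∞) {n : ℕ} (x : Fin n → F) : ℝ :=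
  ⨆ φ : Metric.closedBall (0 : StrongDual ℝ F) 1, strongNorm p fun i => φ.1 (x i)

/-- The Chevet–Saphar norm `d_p` on `F ⊗ G`: the infimum of
`‖(xᵢ)‖_{l_p^{n,w}(F)} * ‖(gᵢ)‖_{l_{p*}^n(G)}` over all representations `z = ∑ xᵢ ⊗ gᵢ`, where
`1 / p + 1 / p* = 1`. -/
def chevetSaphar (p : ℝ≥0∞) (z : F ⊗[ℝ] G) : ℝ :=
  sInf {r : ℝ | ∃ (n : ℕ) (x : Fin n → F) (g : Fin n → G),
    z = ∑ i, x i ⊗ₜ[ℝ] g i ∧ r = weakNorm p x * strongNorm (ENNReal.conjExponent p) g}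

end ChevetSaphar

/-! ### Strictly Lipschitz `p`-summing and strongly Lipschitz `p`-integral maps -/

section Ideals

variable {X : Type v} [MetricSpace X] {x₀ : X}

/-- The Lipschitz cross-norm `d_p^L` of the element `u = ∑ δ_(xᵢ,yᵢ) ⊠ gᵢ` of the Lipschitz tensor
product `X ⊠ G`, that is the Chevet–Saphar norm of its image `∑ δ_(xᵢ,yᵢ) ⊗ gᵢ` in `𝓕(X) ⊗ G`
(the representations in the infimum use arbitrary elements of `𝓕(X)`). -/
def lipChevetSaphar (x₀ : X) {G : Type*} [NormedAddCommGroup G] [NormedSpace ℝ G]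
    (p : ℝ≥0∞) {n : ℕ} (x y : Fin n → X) (g : Fin n → G) : ℝ :=
  chevetSaphar p (∑ i, delta x₀ (x i) (y i) ⊗ₜ[ℝ] g i)

variable {E : Type u} [NormedAddCommGroup E] [NormedSpace ℝ E]

/-- `C` is a constant in the definition of strictly Lipschitz `p`-summing maps:
`|∑ ⟨T xᵢ - T yᵢ, eᵢ*⟩| ≤ C * d_p^L(∑ δ_(xᵢ,yᵢ) ⊠ eᵢ*)` for all finite families. -/
def IsStrictlySummingConst (p : ℝ≥0∞) (T : Lip0 x₀ E) (C : ℝ) : Prop :=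
  0 ≤ C ∧ ∀ (n : ℕ) (x y : Fin n → X) (e : Fin n → StrongDual ℝ E),
    |∑ i, e i (T (x i) - T (y i))| ≤ C * lipChevetSaphar x₀ p x y e

/-- `T` is strictly Lipschitz `p`-summing. -/
def IsStrictlySumming (p : ℝ≥0∞) (T : Lip0 x₀ E) : Prop :=
  ∃ C : ℝ, IsStrictlySummingConst p T C

/-- The strictly Lipschitz `p`-summing norm. -/
def strictlySummingNorm (p : ℝ≥0∞) (T : Lip0 x₀ E) : ℝ :=
  sInf {C : ℝ | IsStrictlySummingConst p T C}

/-- The formal inclusion `I_{∞,p} : L_∞(μ) → L_p(μ)`. -/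
def formalInclusion {Ω : Type*} [MeasurableSpace Ω] (μ : Measure Ω) [IsFiniteMeasure μ]
    (p : ℝ≥0∞) (f : Lp ℝ ∞ μ) : Lp ℝ p μ :=
  AddSubgroup.inclusion (Lp.antitone le_top) f

/-- `(A, b, μ)` is a strongly Lipschitz `p`-integral factorization of `T`:
`K_E ∘ T = A ∘ I_{∞,p} ∘ b`, where `K_E : E → E**` is the canonical embedding. -/
def IsIntegralFactorization (p : ℝ≥0∞) [Fact (1 ≤ p)] (T : Lip0 x₀ E)
    {Ω : Type*} [MeasurableSpace Ω] (μ : Measure Ω) [IsProbabilityMeasure μ]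
    (A : Lp ℝ p μ →L[ℝ] StrongDual ℝ (StrongDual ℝ E)) (b : Lip0 x₀ (Lp ℝ ∞ μ)) : Prop :=
  ∀ x : X, NormedSpace.inclusionInDoubleDual ℝ E (T x) = A (formalInclusion μ p (b x))

/-- `T` is strongly Lipschitz `p`-integral. The probability spaces are taken in the universe of
`X`; this is no restriction, since only the `σ`-algebra generated by the functions `b x` matters
and the measure algebra of the latter has a model in that universe. -/
def IsStronglyIntegral (p : ℝ≥0∞) [Fact (1 ≤ p)] (T : Lip0 x₀ E) : Prop :=
  ∃ (Ω : Type v) (_ : MeasurableSpace Ω) (μ : Measure Ω) (_ : IsProbabilityMeasure μ)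
    (A : Lp ℝ p μ →L[ℝ] StrongDual ℝ (StrongDual ℝ E)) (b : Lip0 x₀ (Lp ℝ ∞ μ)),
    IsIntegralFactorization p T μ A b

/-- The strongly Lipschitz `p`-integral norm: the infimum of `Lip(b) * ‖A‖` over all
factorizations. -/
def stronglyIntegralNorm (p : ℝ≥0∞) [Fact (1 ≤ p)] (T : Lip0 x₀ E) : ℝ :=
  sInf {c : ℝ | ∃ (Ω : Type v) (_ : MeasurableSpace Ω) (μ : Measure Ω)
    (_ : IsProbabilityMeasure μ) (A : Lp ℝ p μ →L[ℝ] StrongDual ℝ (StrongDual ℝ E))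
    (b : Lip0 x₀ (Lp ℝ ∞ μ)), IsIntegralFactorization p T μ A b ∧ c = ‖b‖ * ‖A‖}

end Ideals

/-- `E` is an injective Banach space: every bounded linear operator into `E` from a closed subspace
of a Banach space has a norm-preserving extension to the whole space. (It is enough to test Banach
spaces in the universe of `E`: one of them is the space of bounded functions on the dual unit ball
of `E`, in which `E` is then the range of a projection of norm at most `1`.) -/
def IsInjectiveBanach (E : Type u) [NormedAddCommGroup E] [NormedSpace ℝ E] : Prop :=
  ∀ (F : Type u) [NormedAddCommGroup F] [NormedSpace ℝ F] [CompleteSpace F] (G : Submodule ℝ F),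
    IsClosed (G : Set F) → ∀ w : G →L[ℝ] E,
      ∃ W : F →L[ℝ] E, (∀ g : G, W g = w g) ∧ ‖W‖ = ‖w‖

end LipIdeal

end

/-! A Lipschitz map `T` vanishing at the base point is the trace on the elements δ_(x,y) of a linear
map on the free Banach space. Both properties of `T` say that this linearization is `p`-summing,
once in terms of `chevetSaphar` and once as a factorization through L_∞(μ) → L_p(μ).

An integral factorization linearizes to A ∘ I ∘ B with ‖B‖ ≤ ‖b‖ (`exists_linearization`). The
inclusion I is `p`-summing with constant 1 (`strongNorm_formalInclusion_le`), so Hölder bounds the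
tensor functional of `T` by ‖b‖ * ‖A‖ times `chevetSaphar`. Injectivity plays no role here.

Conversely, testing a strictly summing map on suitable tensors makes its linearization `p`-summing
on combinations of point evaluations (`IsStrictlySummingConst.strongNorm_le`). Pietsch domination
(`exists_pietsch_measure`) then gives a probability measure μ on the dual unit ball of the free
space with the linearization bounded by `C` times the L_p(μ)-norm of the evaluation. It is therefore
a bounded map on a subspace of L_p(μ), and injectivity extends it with norm at most `C`
(`IsInjectiveBanach.exists_extension`). No constant is lost in either direction, so the norms agree.
-/

namespace LipIdeal

/-! ### Finite sequence norms and Hölder duality -/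

section StrongNorm

variable {F : Type*} [NormedAddCommGroup F]
  {G : Type*} [NormedAddCommGroup G] {n : ℕ}

theorem one_le_conjExponent (p : ℝ≥0∞) : 1 ≤ ENNReal.conjExponent p := by
  simp [ENNReal.conjExponent]

theorem toReal_pos_of_fact {p : ℝ≥0∞} [hp1 : Fact (1 ≤ p)] (hp : p ≠ ∞) : 0 < p.toReal :=
  ENNReal.toReal_pos (zero_lt_one.trans_le hp1.out).ne' hp

theorem strongNorm_nonneg (p : ℝ≥0∞) [Fact (1 ≤ p)] (g : Fin n → G) : 0 ≤ strongNorm p g :=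
  norm_nonneg _

theorem strongNorm_eq_sum {p : ℝ≥0∞} (hp : 0 < p.toReal) (g : Fin n → G) :
    strongNorm p g = (∑ i, ‖g i‖ ^ p.toReal) ^ (1 / p.toReal) :=
  PiLp.norm_eq_sum hp _

theorem strongNorm_rpow {p : ℝ≥0∞} (hp : 0 < p.toReal) (g : Fin n → G) :
    strongNorm p g ^ p.toReal = ∑ i, ‖g i‖ ^ p.toReal := by
  rw [strongNorm_eq_sum hp, ← Real.rpow_mul (Finset.sum_nonneg fun i _ => by positivity),
    one_div_mul_cancel hp.ne', Real.rpow_one]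

theorem strongNorm_top (g : Fin n → G) : strongNorm ∞ g = ⨆ i, ‖g i‖ :=
  PiLp.norm_eq_ciSup _

theorem strongNorm_le_of_norm_le (p : ℝ≥0∞) [hp1 : Fact (1 ≤ p)] {f : Fin n → F} {g : Fin n → G}
    (h : ∀ i, ‖f i‖ ≤ ‖g i‖) : strongNorm p f ≤ strongNorm p g := by
  rcases eq_or_ne p ∞ with rfl | hp
  · rw [strongNorm_top, strongNorm_top]
    exact ciSup_mono (Set.finite_range _).bddAbove h
  · have hp0 := toReal_pos_of_fact hp
    rw [strongNorm_eq_sum hp0, strongNorm_eq_sum hp0]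
    gcongr with i
    exact h i

theorem strongNorm_smul [NormedSpace ℝ G] (p : ℝ≥0∞) [Fact (1 ≤ p)] (c : ℝ) (g : Fin n → G) :
    strongNorm p (fun i => c • g i) = |c| * strongNorm p g :=
  norm_smul c (WithLp.toLp p g : PiLp p fun _ : Fin n => G)

theorem continuous_strongNorm (p : ℝ≥0∞) [Fact (1 ≤ p)] :
    Continuous fun g : Fin n → G => strongNorm p g :=
  continuous_norm.comp (PiLp.continuous_toLp p _)

/-- Hölder's inequality. -/
theorem sum_norm_mul_norm_le_strongNorm {p : ℝ≥0∞} [hp1 : Fact (1 ≤ p)] (hp : p ≠ ∞)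
    (f : Fin n → F) (g : Fin n → G) :
    ∑ i, ‖f i‖ * ‖g i‖ ≤ strongNorm p f * strongNorm (ENNReal.conjExponent p) g := by
  have hp0 := toReal_pos_of_fact hp
  -- The conjugate of 1 is `∞`, where the norm is a maximum, so only `1 < p` falls under Hölder for
  -- real exponents.
  rcases eq_or_lt_of_le hp1.out with rfl | h1
  · have hq : ENNReal.conjExponent 1 = ∞ := by simp [ENNReal.conjExponent]
    rw [hq, strongNorm_top, strongNorm_eq_sum hp0]
    simp only [ENNReal.toReal_one, Real.rpow_one, div_one]
    rw [Finset.sum_mul]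
    gcongr with i
    exact le_ciSup (f := fun i => ‖g i‖) (Set.finite_range _).bddAbove i
  · have hq : ENNReal.conjExponent p ≠ ∞ := by
      simp [ENNReal.conjExponent, tsub_eq_zero_iff_le, h1]
    have hpq : p.toReal.HolderConjugate (ENNReal.conjExponent p).toReal :=
      ENNReal.HolderConjugate.toReal_of_ne_top hp hq
    rw [strongNorm_eq_sum hp0, strongNorm_eq_sum hpq.symm.pos]
    simpa using Real.inner_le_Lp_mul_Lq Finset.univ (fun i => ‖f i‖) (fun i => ‖g i‖) hpq

/-- Equality is attained in Hölder's inequality. -/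
theorem exists_sum_mul_norm_eq_strongNorm {p : ℝ≥0∞} [hp1 : Fact (1 ≤ p)] (hp : p ≠ ∞)
    (g : Fin n → G) :
    ∃ b : Fin n → ℝ, (∀ i, 0 ≤ b i) ∧ strongNorm (ENNReal.conjExponent p) b ≤ 1 ∧
      ∑ i, b i * ‖g i‖ = strongNorm p g := by
  have hp0 := toReal_pos_of_fact hp
  rcases eq_or_lt_of_le hp1.out with rfl | h1
  · have hq : ENNReal.conjExponent 1 = ∞ := by simp [ENNReal.conjExponent]
    refine ⟨fun _ => 1, fun _ => zero_le_one, ?_, ?_⟩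
    · rw [hq, strongNorm_top]
      exact Real.iSup_le (fun i => by simp) zero_le_one
    · rw [strongNorm_eq_sum hp0]
      simp
  · have hq : ENNReal.conjExponent p ≠ ∞ := by
      simp [ENNReal.conjExponent, tsub_eq_zero_iff_le, h1]
    have hpq : p.toReal.HolderConjugate (ENNReal.conjExponent p).toReal :=
      ENNReal.HolderConjugate.toReal_of_ne_top hp hq
    obtain ⟨b, hb, hsum⟩ := (NNReal.isGreatest_Lp Finset.univ (fun i => ‖g i‖₊) hpq).1
    refine ⟨fun i => b i, fun i => (b i).2, ?_, ?_⟩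
    · rw [strongNorm_eq_sum hpq.symm.pos]
      refine Real.rpow_le_one (Finset.sum_nonneg fun i _ => by positivity) ?_
        (by have := hpq.symm.pos; positivity)
      have : ((∑ i, b i ^ (ENNReal.conjExponent p).toReal : ℝ≥0) : ℝ) ≤ 1 := by exact_mod_cast hb
      simpa using this
    · rw [strongNorm_eq_sum hp0]
      have := congrArg ((↑) : ℝ≥0 → ℝ) hsum
      push_cast at this
      rw [← this]
      exact Finset.sum_congr rfl fun i _ => mul_comm _ _

/-- Duality of the two sequence norms: absorb the signs of `a` into an extremal `b` for Hölder,
which does not increase the norm of `b`. -/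
theorem strongNorm_le_of_forall_sum_mul_le {p : ℝ≥0∞} [hp1 : Fact (1 ≤ p)] (hp : p ≠ ∞)
    {a : Fin n → ℝ} {M : ℝ} (hM : 0 ≤ M)
    (h : ∀ b : Fin n → ℝ, |∑ i, b i * a i| ≤ M * strongNorm (ENNReal.conjExponent p) b) :
    strongNorm p a ≤ M := by
  have : Fact (1 ≤ ENNReal.conjExponent p) := ⟨one_le_conjExponent p⟩
  obtain ⟨b, hb0, hb1, hb⟩ := exists_sum_mul_norm_eq_strongNorm hp a
  have hsgn : ∀ i, b i * ‖a i‖ = (b i * SignType.sign (a i)) * a i := fun i => by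
    rw [mul_assoc, sign_mul_self, Real.norm_eq_abs]
  rw [← hb, Finset.sum_congr rfl fun i _ => hsgn i]
  refine (le_abs_self _).trans ((h _).trans (mul_le_of_le_one_right hM (le_trans ?_ hb1)))
  refine strongNorm_le_of_norm_le _ fun i => ?_
  rw [norm_mul]
  refine mul_le_of_le_one_right (norm_nonneg _) ?_
  rcases SignType.sign (a i) with _ | _ | _ <;> simp

end StrongNorm

/-! ### The weak norm and the Chevet–Saphar norm -/

section WeakNorm

variable {F : Type*} [NormedAddCommGroup F] [NormedSpace ℝ F]
  {G : Type*} [NormedAddCommGroup G] [NormedSpace ℝ G] {n : ℕ}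

theorem bddAbove_strongNorm_dual (p : ℝ≥0∞) [Fact (1 ≤ p)] (x : Fin n → F) :
    BddAbove (Set.range fun φ : Metric.closedBall (0 : StrongDual ℝ F) 1 =>
      strongNorm p fun i => φ.1 (x i)) := by
  refine ⟨strongNorm p x, ?_⟩
  rintro _ ⟨φ, rfl⟩
  refine strongNorm_le_of_norm_le p fun i => ?_
  exact (φ.1.le_of_opNorm_le (mem_closedBall_zero_iff.1 φ.2) _).trans_eq (one_mul _)

theorem strongNorm_le_weakNorm (p : ℝ≥0∞) [Fact (1 ≤ p)] (x : Fin n → F) {φ : StrongDual ℝ F}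
    (hφ : ‖φ‖ ≤ 1) : strongNorm p (fun i => φ (x i)) ≤ weakNorm p x :=
  le_ciSup (bddAbove_strongNorm_dual p x) ⟨φ, mem_closedBall_zero_iff.2 hφ⟩

theorem weakNorm_nonneg (p : ℝ≥0∞) [Fact (1 ≤ p)] (x : Fin n → F) : 0 ≤ weakNorm p x :=
  Real.iSup_nonneg fun _ => strongNorm_nonneg p _

/-- Hölder applied after a norming functional of the sum. It lets weak norms be transported through
operators via linear combinations alone. -/
theorem norm_sum_smul_le_weakNorm {p : ℝ≥0∞} [Fact (1 ≤ p)] (hp : p ≠ ∞) (x : Fin n → F)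
    (b : Fin n → ℝ) :
    ‖∑ i, b i • x i‖ ≤ weakNorm p x * strongNorm (ENNReal.conjExponent p) b := by
  have : Fact (1 ≤ ENNReal.conjExponent p) := ⟨one_le_conjExponent p⟩
  obtain ⟨φ, hφ1, hφ⟩ := exists_dual_vector'' ℝ (∑ i, b i • x i)
  have hφ' : ‖∑ i, b i • x i‖ = ∑ i, b i * φ (x i) := by
    simpa using hφ.symm
  rw [hφ']
  calc ∑ i, b i * φ (x i) ≤ ∑ i, ‖φ (x i)‖ * ‖b i‖ := by
        refine Finset.sum_le_sum fun i _ => ?_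
        rw [← norm_mul, mul_comm]
        exact le_abs_self _
    _ ≤ strongNorm p (fun i => φ (x i)) * strongNorm (ENNReal.conjExponent p) b :=
        sum_norm_mul_norm_le_strongNorm hp _ _
    _ ≤ _ := by
        gcongr
        · exact strongNorm_nonneg _ _
        · exact strongNorm_le_weakNorm p x hφ1

theorem chevetSaphar_sum_tmul_le (p : ℝ≥0∞) [Fact (1 ≤ p)] (x : Fin n → F) (g : Fin n → G) :
    chevetSaphar p (∑ i, x i ⊗ₜ[ℝ] g i) ≤
      weakNorm p x * strongNorm (ENNReal.conjExponent p) g := by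
  have : Fact (1 ≤ ENNReal.conjExponent p) := ⟨one_le_conjExponent p⟩
  refine csInf_le ⟨0, ?_⟩ ⟨n, x, g, rfl, rfl⟩
  rintro _ ⟨m, x', g', -, rfl⟩
  exact mul_nonneg (weakNorm_nonneg _ _) (strongNorm_nonneg _ _)

/-- A linear functional on `F ⊗ G` is bounded by `c * d_p` if it is so on all representations. -/
theorem abs_le_mul_chevetSaphar (p : ℝ≥0∞) (Ψ : F ⊗[ℝ] G →ₗ[ℝ] ℝ) {c : ℝ}
    (hc : 0 ≤ c)
    (h : ∀ (m : ℕ) (x : Fin m → F) (g : Fin m → G), |∑ i, Ψ (x i ⊗ₜ[ℝ] g i)| ≤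
      c * (weakNorm p x * strongNorm (ENNReal.conjExponent p) g))
    (x : Fin n → F) (g : Fin n → G) :
    |Ψ (∑ i, x i ⊗ₜ[ℝ] g i)| ≤ c * chevetSaphar p (∑ i, x i ⊗ₜ[ℝ] g i) := by
  have key : ∀ r ∈ {r : ℝ | ∃ (m : ℕ) (x' : Fin m → F) (g' : Fin m → G),
      ∑ i, x i ⊗ₜ[ℝ] g i = ∑ i, x' i ⊗ₜ[ℝ] g' i ∧
        r = weakNorm p x' * strongNorm (ENNReal.conjExponent p) g'},
      |Ψ (∑ i, x i ⊗ₜ[ℝ] g i)| ≤ c * r := by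
    rintro _ ⟨m, x', g', hz, rfl⟩
    rw [hz, map_sum]
    exact h m x' g'
  have hne : {r : ℝ | ∃ (m : ℕ) (x' : Fin m → F) (g' : Fin m → G),
      ∑ i, x i ⊗ₜ[ℝ] g i = ∑ i, x' i ⊗ₜ[ℝ] g' i ∧
        r = weakNorm p x' * strongNorm (ENNReal.conjExponent p) g'}.Nonempty :=
    ⟨_, n, x, g, rfl, rfl⟩
  -- Division by `c` needs `c ≠ 0`; for `c = 0` a single representation already forces the value to
  -- vanish.
  rcases hc.eq_or_lt with rfl | hc
  · obtain ⟨r, hr⟩ := hne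
    simpa using key r hr
  · rw [mul_comm, ← div_le_iff₀ hc]
    refine le_csInf hne fun r hr => ?_
    rw [div_le_iff₀ hc, mul_comm]
    exact key r hr

end WeakNorm

/-! ### Linearization on the free Banach space -/

section Linearization

variable {X : Type v} [MetricSpace X] {x₀ : X}

/-- Composition of a Lipschitz map with continuous functionals. -/
noncomputable def Lip0.compDual {Y : Type u} [NormedAddCommGroup Y] [NormedSpace ℝ Y] (b : Lip0 x₀ Y) :
    StrongDual ℝ Y →L[ℝ] Lip0 x₀ ℝ :=
  LinearMap.mkContinuous
    { toFun := fun φ => Lip0.mk (fun x => φ (b x)) (by simp [b.apply_base])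
        (by
          obtain ⟨K, hK⟩ := b.exists_lipschitzWith
          exact ⟨_, φ.lipschitz.comp hK⟩)
      map_add' := fun _ _ => rfl
      map_smul' := fun _ _ => rfl }
    ‖b‖
    (fun φ => by
      refine Lip0.norm_le (mul_nonneg (norm_nonneg _) (norm_nonneg _)) fun x y => ?_
      change ‖φ (b x) - φ (b y)‖ ≤ _
      rw [← map_sub]
      calc ‖φ (b x - b y)‖ ≤ ‖φ‖ * ‖b x - b y‖ := φ.le_opNorm _
        _ ≤ ‖φ‖ * (‖b‖ * dist x y) := by
            gcongr
            exact b.norm_sub_le x y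
        _ = ‖b‖ * ‖φ‖ * dist x y := by ring)

theorem Lip0.norm_compDual_le {Y : Type u} [NormedAddCommGroup Y] [NormedSpace ℝ Y]
    (b : Lip0 x₀ Y) : ‖b.compDual‖ ≤ ‖b‖ :=
  LinearMap.mkContinuous_norm_le _ (norm_nonneg _) _

/-- The universal property of the free Banach space: a Lipschitz map into a Banach space is
linearized with the same norm. -/
theorem exists_linearization {Y : Type u} [NormedAddCommGroup Y] [NormedSpace ℝ Y]
    [CompleteSpace Y] (b : Lip0 x₀ Y) :
    ∃ B : FreeBanach x₀ →ₗ[ℝ] Y, (∀ x y, B (delta x₀ x y) = b x - b y) ∧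
      ∀ u, ‖B u‖ ≤ ‖b‖ * ‖u‖ := by
  set ι := NormedSpace.inclusionInDoubleDualLi (E := Y) ℝ
  have hcl : IsClosed (Set.range ι) := ι.isometry.isClosedEmbedding.isClosed_range
  let D : StrongDual ℝ (Lip0 x₀ ℝ) →L[ℝ] StrongDual ℝ (StrongDual ℝ Y) :=
    ContinuousLinearMap.precomp ℝ b.compDual
  have hD : ∀ x y, D (evalDiff x₀ x y) = ι (b x - b y) := fun x y => by
    ext φ
    change φ (b x) - φ (b y) = φ (b x - b y)
    rw [map_sub]
  -- The transpose `D` lands a priori in the bidual of `Y`. As `Y` is complete its canonical image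
  -- is closed, so the preimage contains the closed span once it contains the generators.
  have hle : FreeBanach x₀ ≤ (LinearMap.range ι.toLinearMap).comap D.toLinearMap := by
    refine Submodule.topologicalClosure_minimal _ ?_ (hcl.preimage D.continuous)
    rw [Submodule.span_le]
    rintro _ ⟨q, rfl⟩
    exact ⟨b q.1 - b q.2, (hD _ _).symm⟩
  let e := LinearEquiv.ofInjective ι.toLinearMap ι.injective
  let B : FreeBanach x₀ →ₗ[ℝ] Y := e.symm.toLinearMap ∘ₗ
    ((D.toLinearMap.domRestrict _).codRestrict (LinearMap.range ι.toLinearMap)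
      fun u => hle u.2)
  have hB : ∀ u : FreeBanach x₀, ι (B u) = D u := fun u =>
    congrArg Subtype.val (e.apply_symm_apply ⟨D u, hle u.2⟩)
  refine ⟨B, fun x y => ι.injective ?_, fun u => ?_⟩
  · rw [hB]
    exact hD x y
  · rw [← ι.norm_map, hB]
    refine ContinuousLinearMap.opNorm_le_bound _ (by positivity) fun φ => ?_
    calc ‖(u : StrongDual ℝ (Lip0 x₀ ℝ)) (b.compDual φ)‖
        ≤ ‖(u : StrongDual ℝ (Lip0 x₀ ℝ))‖ * (‖b‖ * ‖φ‖) := by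
          refine ContinuousLinearMap.le_opNorm_of_le _ ?_
          exact b.compDual.le_of_opNorm_le b.norm_compDual_le φ
      _ = ‖b‖ * ‖u‖ * ‖φ‖ := by rw [Submodule.coe_norm]; ring

end Linearization

/-! ### The formal inclusion is `p`-summing -/

section FormalInclusion

variable {Ω : Type*} [MeasurableSpace Ω] {μ : Measure Ω}

theorem coeFn_formalInclusion [IsFiniteMeasure μ] (p : ℝ≥0∞) (f : Lp ℝ ∞ μ) :
    (formalInclusion μ p f : Ω → ℝ) = f := rfl

/-- The formal inclusion as a linear map. -/
noncomputable def formalInclusionₗ (μ : Measure Ω) [IsFiniteMeasure μ] (p : ℝ≥0∞) :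
    Lp ℝ ∞ μ →ₗ[ℝ] Lp ℝ p μ where
  toFun := formalInclusion μ p
  map_add' _ _ := rfl
  map_smul' _ _ := rfl

theorem norm_Lp_rpow_eq_integral {p : ℝ≥0∞} [hp1 : Fact (1 ≤ p)] (hp : p ≠ ∞) (f : Lp ℝ p μ) :
    ‖f‖ ^ p.toReal = ∫ ω, ‖f ω‖ ^ p.toReal ∂μ := by
  have hp0 := toReal_pos_of_fact hp
  rw [Lp.norm_def, (Lp.memLp f).eLpNorm_eq_integral_rpow_norm (zero_lt_one.trans_le hp1.out).ne' hp,
    ENNReal.toReal_ofReal (by positivity), ← Real.rpow_mul (by positivity),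
    inv_mul_cancel₀ hp0.ne', Real.rpow_one]

/-- The formal inclusion `L_∞(μ) → L_p(μ)` is `p`-summing with constant `1`; the weak norm of the
family in `L_∞(μ)` is replaced with any bound on its linear combinations. -/
theorem strongNorm_formalInclusion_le [IsProbabilityMeasure μ] {p : ℝ≥0∞} [hp1 : Fact (1 ≤ p)] (hp : p ≠ ∞) {n : ℕ}
    (h : Fin n → Lp ℝ ∞ μ) {M : ℝ} (hM : 0 ≤ M)
    (hh : ∀ a : Fin n → ℝ, ‖∑ i, a i • h i‖ ≤ M * strongNorm (ENNReal.conjExponent p) a) :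
    strongNorm p (fun i => formalInclusion μ p (h i)) ≤ M := by
  have : Fact (1 ≤ ENNReal.conjExponent p) := ⟨one_le_conjExponent p⟩
  have hp0 := toReal_pos_of_fact hp
  have hcomb : ∀ a : Fin n → ℝ, ∀ᵐ ω ∂μ,
      |∑ i, a i * h i ω| ≤ M * strongNorm (ENNReal.conjExponent p) a := fun a => by
    have h1 : ∀ᵐ ω ∂μ, ‖(∑ i, a i • h i : Lp ℝ ∞ μ) ω‖ ≤ ‖∑ i, a i • h i‖ := by
      have := ae_le_eLpNormEssSup (μ := μ) (f := (∑ i, a i • h i : Lp ℝ ∞ μ))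
      filter_upwards [this] with ω hω
      rw [Lp.norm_def, eLpNorm_exponent_top, ← toReal_enorm]
      refine ENNReal.toReal_mono ?_ hω
      rw [← eLpNorm_exponent_top]
      exact Lp.eLpNorm_ne_top _
    have h2 : ∀ᵐ ω ∂μ, (∑ i, a i • h i : Lp ℝ ∞ μ) ω = ∑ i, a i * h i ω := by
      have h3 : ∀ᵐ ω ∂μ, ∀ i, (a i • h i : Lp ℝ ∞ μ) ω = a i * h i ω :=
        ae_all_iff.2 fun i => by
          filter_upwards [Lp.coeFn_smul (a i) (h i)] with ω hω
          rw [hω]; rfl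
      filter_upwards [Lp.coeFn_finsetSum Finset.univ fun i => a i • h i, h3] with ω hω h3
      rw [hω, Finset.sum_apply]
      exact Finset.sum_congr rfl fun i _ => h3 i
    filter_upwards [h1, h2] with ω h1 h2
    rw [← h2]
    exact h1.trans (hh a)
  -- The null set in `hcomb` depends on `a`. Using only a countable dense set of `a` gives one null
  -- set, and continuity in `a` recovers all coefficients.
  have hall : ∀ᵐ ω ∂μ, strongNorm p (fun i => h i ω) ≤ M := by
    filter_upwards [ae_all_iff.2 fun k => hcomb (TopologicalSpace.denseSeq (Fin n → ℝ) k)]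
      with ω hω
    refine strongNorm_le_of_forall_sum_mul_le hp hM fun a => ?_
    refine (TopologicalSpace.denseRange_denseSeq (Fin n → ℝ)).induction_on a ?_ hω
    have := continuous_strongNorm (G := ℝ) (n := n) (ENNReal.conjExponent p)
    exact isClosed_le (by fun_prop) (by fun_prop)
  have hint : ∀ i, Integrable (fun ω => ‖h i ω‖ ^ p.toReal) μ := fun i =>
    (Lp.memLp (formalInclusion μ p (h i))).integrable_norm_rpow
      (zero_lt_one.trans_le hp1.out).ne' hp
  refine (Real.rpow_le_rpow_iff (strongNorm_nonneg _ _) hM hp0).1 ?_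
  rw [strongNorm_rpow hp0]
  simp only [norm_Lp_rpow_eq_integral hp, coeFn_formalInclusion]
  rw [← integral_finsetSum _ fun i _ => hint i]
  calc ∫ ω, ∑ i, ‖h i ω‖ ^ p.toReal ∂μ ≤ ∫ _, M ^ p.toReal ∂μ := by
        refine integral_mono_ae (integrable_finsetSum _ fun i _ => hint i)
          (integrable_const _) ?_
        filter_upwards [hall] with ω hω
        rw [← strongNorm_rpow hp0 fun i => h i ω]
        exact Real.rpow_le_rpow (strongNorm_nonneg _ _) hω hp0.le
    _ = M ^ p.toReal := by simp

end FormalInclusion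

/-! ### Integral maps are summing -/

section IntegralToSumming

variable {X : Type v} [MetricSpace X] {x₀ : X}
  {E : Type u} [NormedAddCommGroup E] [NormedSpace ℝ E]

/-- The linearization `S` of `K_E ∘ T` induces a functional on the tensor product which on δ_(x,y) ⊗
e is e(T x - T y). Being linear, it may be estimated on any representation of the tensor. -/
theorem IsIntegralFactorization.isStrictlySummingConst {p : ℝ≥0∞} [hp1 : Fact (1 ≤ p)]
    (hp : p ≠ ∞) {T : Lip0 x₀ E} {Ω : Type*} [MeasurableSpace Ω] {μ : Measure Ω}
    [IsProbabilityMeasure μ] {A : Lp ℝ p μ →L[ℝ] StrongDual ℝ (StrongDual ℝ E)}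
    {b : Lip0 x₀ (Lp ℝ ∞ μ)} (h : IsIntegralFactorization p T μ A b) :
    IsStrictlySummingConst p T (‖b‖ * ‖A‖) := by
  have : Fact (1 ≤ ENNReal.conjExponent p) := ⟨one_le_conjExponent p⟩
  obtain ⟨B, hB, hBn⟩ := exists_linearization b
  let S : FreeBanach x₀ →ₗ[ℝ] StrongDual ℝ (StrongDual ℝ E) :=
    A.toLinearMap ∘ₗ formalInclusionₗ μ p ∘ₗ B
  have hSδ : ∀ (x y : X) (e : StrongDual ℝ E), S (delta x₀ x y) e = e (T x - T y) := by
    intro x y e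
    have : S (delta x₀ x y) = A (formalInclusionₗ μ p (b x)) - A (formalInclusionₗ μ p (b y)) := by
      change A (formalInclusionₗ μ p (B (delta x₀ x y))) = _
      rw [hB, map_sub, map_sub]
    rw [this]
    change (A (formalInclusion μ p (b x)) - A (formalInclusion μ p (b y))) e = _
    rw [← h x, ← h y, map_sub]
    rfl
  let Ψ : FreeBanach x₀ ⊗[ℝ] StrongDual ℝ E →ₗ[ℝ] ℝ :=
    TensorProduct.lift (ContinuousLinearMap.coeLM ℝ ∘ₗ S)
  have hΨ : ∀ u e, Ψ (u ⊗ₜ[ℝ] e) = S u e := fun u e => TensorProduct.lift.tmul _ _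
  refine ⟨by positivity, fun n x y e => ?_⟩
  have key := abs_le_mul_chevetSaphar p Ψ (c := ‖b‖ * ‖A‖) (by positivity) ?_
    (fun i => delta x₀ (x i) (y i)) e
  · rw [map_sum] at key
    simp only [hΨ, hSδ] at key
    exact key
  intro m u g
  simp only [hΨ]
  have hI : strongNorm p (fun i => formalInclusion μ p (B (u i))) ≤ ‖b‖ * weakNorm p u := by
    refine strongNorm_formalInclusion_le hp _
      (mul_nonneg (norm_nonneg _) (weakNorm_nonneg _ _)) fun a => ?_
    have : ∑ i, a i • B (u i) = B (∑ i, a i • u i) := by simp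
    rw [this, mul_assoc]
    refine (hBn _).trans ?_
    gcongr
    exact norm_sum_smul_le_weakNorm hp u a
  calc |∑ i, S (u i) (g i)| ≤ ∑ i, ‖S (u i)‖ * ‖g i‖ :=
        (Finset.abs_sum_le_sum_abs _ _).trans
          (Finset.sum_le_sum fun i _ => (S (u i)).le_opNorm (g i))
    _ ≤ ∑ i, ‖‖A‖ • formalInclusion μ p (B (u i))‖ * ‖g i‖ := by
        refine Finset.sum_le_sum fun i _ => mul_le_mul_of_nonneg_right ?_ (norm_nonneg _)
        rw [norm_smul, norm_norm]
        exact A.le_opNorm _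
    _ ≤ strongNorm p (fun i => ‖A‖ • formalInclusion μ p (B (u i))) *
          strongNorm (ENNReal.conjExponent p) g := sum_norm_mul_norm_le_strongNorm hp _ _
    _ ≤ (‖A‖ * (‖b‖ * weakNorm p u)) * strongNorm (ENNReal.conjExponent p) g := by
        refine mul_le_mul_of_nonneg_right ?_ (strongNorm_nonneg _ _)
        rw [strongNorm_smul, abs_norm]
        gcongr
    _ = _ := by ring

end IntegralToSumming

/-! ### Extension of operators into an injective space -/

section Extension

/-- A Hahn–Banach extension through a (not necessarily injective) linear map. -/
theorem exists_strongDual_of_abs_le {V : Type*} [AddCommGroup V] [Module ℝ V]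
    {L : Type*} [NormedAddCommGroup L] [NormedSpace ℝ L] (J : V →ₗ[ℝ] L) (f : V →ₗ[ℝ] ℝ)
    {C : ℝ} (hC : 0 ≤ C) (h : ∀ v, |f v| ≤ C * ‖J v‖) :
    ∃ g : StrongDual ℝ L, (∀ v, g (J v) = f v) ∧ ‖g‖ ≤ C := by
  obtain ⟨s, hs⟩ := J.rangeRestrict.exists_rightInverse_of_surjective J.range_rangeRestrict
  have hs' : ∀ r, J (s r) = r := fun r => congrArg Subtype.val (LinearMap.congr_fun hs r)
  let g₀ : StrongDual ℝ (LinearMap.range J) := (f ∘ₗ s).mkContinuous C fun r => by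
    have := h (s r)
    rwa [hs'] at this
  obtain ⟨g, hg, hgn⟩ := _root_.exists_extension_norm_eq (LinearMap.range J) g₀
  refine ⟨g, fun v => ?_, hgn.trans_le (LinearMap.mkContinuous_norm_le _ hC _)⟩
  have h1 : g (J v) = f (s (J.rangeRestrict v)) := hg (J.rangeRestrict v)
  -- The bound forces `f` to vanish on the kernel of `J`, so the choice of the section `s` is
  -- immaterial.
  have h2 := h (s (J.rangeRestrict v) - v)
  have h3 : J (s (J.rangeRestrict v) - v) = 0 := by
    rw [map_sub, hs']
    simp
  rw [h3, norm_zero, mul_zero] at h2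
  rw [h1, ← sub_eq_zero, ← map_sub]
  exact abs_nonpos_iff.1 h2

variable (E : Type u) [NormedAddCommGroup E] [NormedSpace ℝ E]

/-- The isometric embedding of `E` into the bounded functions on its dual unit ball. -/
noncomputable def toLinftyDualBall :
    E →ₗᵢ[ℝ] lp (fun _ : Metric.closedBall (0 : StrongDual ℝ E) 1 => ℝ) ∞ where
  toFun x := ⟨fun φ => φ.1 x, memℓp_infty ⟨‖x‖, by
    rintro _ ⟨φ, rfl⟩
    exact (φ.1.le_of_opNorm_le (mem_closedBall_zero_iff.1 φ.2) _).trans_eq (one_mul _)⟩⟩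
  map_add' x y := lp.ext (funext fun φ => map_add φ.1 x y)
  map_smul' c x := lp.ext (funext fun φ => map_smul φ.1 c x)
  norm_map' x := by
    refine le_antisymm (lp.norm_le_of_forall_le (norm_nonneg _) fun φ =>
      (φ.1.le_of_opNorm_le (mem_closedBall_zero_iff.1 φ.2) _).trans_eq (one_mul _)) ?_
    obtain ⟨φ, hφ1, hφ⟩ := exists_dual_vector'' ℝ x
    refine le_trans (le_of_eq ?_)
      (lp.norm_apply_le_norm ENNReal.top_ne_zero _ ⟨φ, mem_closedBall_zero_iff.2 hφ1⟩)
    change ‖x‖ = ‖φ x‖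
    rw [hφ]
    simp

variable {E}

/-- The extension property of an injective Banach space, for spaces in any universe and through a
not necessarily injective linear map. -/
theorem IsInjectiveBanach.exists_extension [CompleteSpace E] (hE : IsInjectiveBanach E)
    {V : Type*} [AddCommGroup V] [Module ℝ V] {L : Type*} [NormedAddCommGroup L] [NormedSpace ℝ L]
    (J : V →ₗ[ℝ] L) (f : V →ₗ[ℝ] E) {C : ℝ} (hC : 0 ≤ C) (h : ∀ v, ‖f v‖ ≤ C * ‖J v‖) :
    ∃ W : L →L[ℝ] E, (∀ v, W (J v) = f v) ∧ ‖W‖ ≤ C := by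
  set ι := toLinftyDualBall E
  have hcl : IsClosed (LinearMap.range ι.toLinearMap :
      Set (lp (fun _ : Metric.closedBall (0 : StrongDual ℝ E) 1 => ℝ) ∞)) :=
    ι.isometry.isClosedEmbedding.isClosed_range
  let e := ι.equivRange
  -- Injectivity is used only here, in the universe of `E`: it yields a projection onto the copy of
  -- `E`. Elsewhere Hahn–Banach extends each coordinate.
  obtain ⟨P, hP, hPn⟩ := hE _ _ hcl (e.symm.toContinuousLinearEquiv : _ →L[ℝ] E)
  have hPι : ∀ x, P (ι x) = x := fun x => (hP (e x)).trans (e.symm_apply_apply x)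
  have hP1 : ‖P‖ ≤ 1 := by
    rw [hPn]
    exact ContinuousLinearMap.opNorm_le_bound _ zero_le_one fun g => by
      rw [one_mul]; exact (e.symm.norm_map g).le
  have hext : ∀ φ : Metric.closedBall (0 : StrongDual ℝ E) 1,
      ∃ g : StrongDual ℝ L, (∀ v, g (J v) = φ.1 (f v)) ∧ ‖g‖ ≤ C := fun φ =>
    exists_strongDual_of_abs_le J (φ.1.toLinearMap ∘ₗ f) hC fun v =>
      ((φ.1.le_of_opNorm_le (mem_closedBall_zero_iff.1 φ.2) _).trans_eq (one_mul _)).trans (h v)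
  choose g hg hgn using hext
  let W₀ : L →L[ℝ] lp (fun _ : Metric.closedBall (0 : StrongDual ℝ E) 1 => ℝ) ∞ :=
    LinearMap.mkContinuous
      { toFun := fun x => ⟨fun φ => g φ x, memℓp_infty ⟨C * ‖x‖, by
          rintro _ ⟨φ, rfl⟩
          exact (g φ).le_of_opNorm_le (hgn φ) x⟩⟩
        map_add' := fun x y => lp.ext (funext fun φ => map_add (g φ) x y)
        map_smul' := fun c x => lp.ext (funext fun φ => map_smul (g φ) c x) }
      C
      (fun x => lp.norm_le_of_forall_le (by positivity) fun φ =>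
        (g φ).le_of_opNorm_le (hgn φ) x)
  refine ⟨P ∘L W₀, fun v => ?_, ?_⟩
  · have : W₀ (J v) = ι (f v) := lp.ext (funext fun φ => hg φ v)
    rw [ContinuousLinearMap.comp_apply, this, hPι]
  · refine (P.opNorm_comp_le W₀).trans ?_
    calc ‖P‖ * ‖W₀‖ ≤ 1 * C :=
          mul_le_mul hP1 (LinearMap.mkContinuous_norm_le _ hC _) (norm_nonneg _) zero_le_one
      _ = C := one_mul C

end Extension

/-! ### A common measure by Hahn–Banach and Riesz -/

section Separation

variable {K : Type*} [TopologicalSpace K] [CompactSpace K] [T2Space K]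

/-- The Riesz–Markov–Kakutani theorem on a compact space, for functionals on `C(K)`. -/
theorem exists_isFiniteMeasure_integral_eq [MeasurableSpace K] [BorelSpace K]
    (Λ : C(K, ℝ) →ₗ[ℝ] ℝ) (hΛ : ∀ f, 0 ≤ f → 0 ≤ Λ f) :
    ∃ μ : Measure K, IsFiniteMeasure μ ∧ ∀ f : C(K, ℝ), ∫ x, f x ∂μ = Λ f := by
  let Λ' : CompactlySupportedContinuousMap K ℝ →ₚ[ℝ] ℝ := PositiveLinearMap.mk₀
    { toFun := fun f => Λ f.toContinuousMap
      map_add' := fun f g => map_add Λ f.toContinuousMap g.toContinuousMap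
      map_smul' := fun c f => map_smul Λ c f.toContinuousMap }
    (fun f hf => hΛ _ hf)
  refine ⟨RealRMK.rieszMeasure Λ', ?_, fun f => ?_⟩
  · refine ⟨?_⟩
    exact isCompact_univ.measure_lt_top
  · exact RealRMK.integral_rieszMeasure Λ' (CompactlySupportedContinuousMap.continuousMapEquiv f)

/-- If no function in a convex set `S ⊆ C(K)` containing `0` is strictly positive, then all
functions in `S` have nonpositive integral for some common probability measure. -/
theorem exists_isProbabilityMeasure_integral_nonpos [MeasurableSpace K] [BorelSpace K]
    {S : Set C(K, ℝ)} (hS : Convex ℝ S) (h0 : (0 : C(K, ℝ)) ∈ S)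
    (hneg : ∀ f ∈ S, ∃ x, f x ≤ 0) :
    ∃ μ : Measure K, IsProbabilityMeasure μ ∧ ∀ f ∈ S, ∫ x, f x ∂μ ≤ 0 := by
  obtain ⟨x₁, -⟩ := hneg 0 h0
  have : Nonempty K := ⟨x₁⟩
  let P : Set C(K, ℝ) := {f | ∀ x, f x ∈ Set.Ioi (0 : ℝ)}
  have hPo : IsOpen P := by
    have := ContinuousMap.isOpen_setOfPred_mapsTo (X := K) (Y := ℝ) isCompact_univ
      (isOpen_Ioi (a := (0 : ℝ)))
    simpa [P, Set.MapsTo] using this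
  have hPc : Convex ℝ P := fun f hf g hg a b ha hb hab x =>
    (convex_Ioi (0 : ℝ)) (hf x) (hg x) ha hb hab
  have hdisj : Disjoint P S := Set.disjoint_left.2 fun f hfP hfS => by
    obtain ⟨x, hx⟩ := hneg f hfS
    exact absurd (hfP x) (not_lt.2 hx)
  -- Separate `S` from the open cone of strictly positive functions; `-Λ`, normalized at the
  -- constant 1, will be the integral.
  obtain ⟨Λ, s, hΛP, hΛS⟩ := geometric_hahn_banach_open hPc hPo hS hdisj
  have hs0 : s ≤ 0 := by simpa using hΛS 0 h0
  have hΛneg : ∀ f ∈ P, Λ f < 0 := fun f hf => (hΛP f hf).trans_le hs0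
  have hone : (1 : C(K, ℝ)) ∈ P := fun x => zero_lt_one (α := ℝ)
  have hs : s = 0 := by
    refine le_antisymm hs0 ?_
    by_contra! hlt
    have h1 := hΛneg 1 hone
    -- This multiple of the constant 1 has Λ-value `s / 2`, which exceeds a negative `s`.
    have hc : 0 < s / Λ 1 / 2 := half_pos (div_pos_of_neg_of_neg hlt h1)
    have := hΛP ((s / Λ 1 / 2) • 1) fun x => by
      simpa using hc
    rw [map_smul, smul_eq_mul, div_right_comm, div_mul_cancel₀ _ h1.ne] at this
    linarith
  have hΛnonpos : ∀ f : C(K, ℝ), 0 ≤ f → Λ f ≤ 0 := fun f hf => by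
    by_contra! hlt
    have h1 := hΛneg 1 hone
    -- Adding this multiple of 1 makes `f` strictly positive while bringing its Λ-value to exactly
    -- 0.
    have hc : 0 < Λ f / (-Λ 1) := div_pos hlt (neg_pos.2 h1)
    have := hΛneg (f + (Λ f / (-Λ 1)) • 1) fun x => by
      have := hf x
      simpa using add_pos_of_nonneg_of_pos this hc
    rw [map_add, map_smul, smul_eq_mul, div_neg, neg_mul, div_mul_cancel₀ _ h1.ne] at this
    simp at this
  have hΛ1 : 0 < -Λ 1 := neg_pos.2 (hΛneg 1 hone)
  obtain ⟨μ, hμf, hμ⟩ := exists_isFiniteMeasure_integral_eq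
    ((-Λ 1)⁻¹ • -Λ.toLinearMap) fun f hf => by
      simpa using mul_nonneg (inv_nonneg.2 hΛ1.le) (neg_nonneg.2 (hΛnonpos f hf))
  refine ⟨μ, ?_, fun f hf => ?_⟩
  · have h1 := hμ 1
    have h2 : (-Λ 1)⁻¹ * (-Λ 1) = 1 := inv_mul_cancel₀ hΛ1.ne'
    have h3 : μ.real Set.univ = 1 := by
      rw [← h2]
      simpa using h1
    refine ⟨?_⟩
    rw [measureReal_def, ENNReal.toReal_eq_one_iff] at h3
    exact h3
  · rw [hμ]
    have : 0 ≤ Λ f := hs ▸ hΛS f hf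
    simpa using mul_nonneg (inv_nonneg.2 hΛ1.le) this

end Separation

/-! ### The weak-* compact dual ball and Pietsch domination -/

section DualBall

variable (F : Type*) [NormedAddCommGroup F] [NormedSpace ℝ F]

/-- The dual unit ball, a compact space in the weak-* topology. -/
def DualBall : Type _ :=
  ↥((WeakDual.toStrongDual (𝕜 := ℝ) (E := F)) ⁻¹' Metric.closedBall (0 : StrongDual ℝ F) 1)

instance : TopologicalSpace (DualBall F) := inferInstanceAs (TopologicalSpace
  ↥((WeakDual.toStrongDual (𝕜 := ℝ) (E := F)) ⁻¹' Metric.closedBall (0 : StrongDual ℝ F) 1))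

instance : T2Space (DualBall F) := inferInstanceAs (T2Space
  ↥((WeakDual.toStrongDual (𝕜 := ℝ) (E := F)) ⁻¹' Metric.closedBall (0 : StrongDual ℝ F) 1))

instance : CompactSpace (DualBall F) :=
  isCompact_iff_compactSpace.1 (WeakDual.isCompact_closedBall (0 : StrongDual ℝ F) 1)

instance : MeasurableSpace (DualBall F) := borel _

instance : BorelSpace (DualBall F) := ⟨rfl⟩

variable {F}

/-- The functional underlying an element of the dual unit ball. -/
noncomputable def DualBall.toDual (φ : DualBall F) : StrongDual ℝ F := WeakDual.toStrongDual φ.1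

theorem DualBall.norm_toDual_le (φ : DualBall F) : ‖φ.toDual‖ ≤ 1 :=
  mem_closedBall_zero_iff.1 φ.2

theorem DualBall.norm_toDual_apply_le (φ : DualBall F) (x : F) : ‖φ.toDual x‖ ≤ ‖x‖ :=
  (φ.toDual.le_of_opNorm_le φ.norm_toDual_le x).trans_eq (one_mul _)

instance : Nonempty (DualBall F) :=
  ⟨⟨(WeakDual.toStrongDual (𝕜 := ℝ) (E := F)).symm 0, by simp⟩⟩

theorem DualBall.continuous_toDual_apply (x : F) : Continuous fun φ : DualBall F => φ.toDual x :=
  (WeakDual.eval_continuous x).comp continuous_subtype_val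

/-- Evaluation, as an operator from `F` to the continuous functions on its dual unit ball. -/
noncomputable def dualBallEval : F →ₗ[ℝ] C(DualBall F, ℝ) where
  toFun x := ⟨fun φ => φ.toDual x, DualBall.continuous_toDual_apply x⟩
  map_add' x y := by ext φ; exact map_add φ.toDual x y
  map_smul' c x := by ext φ; exact map_smul φ.toDual c x

theorem dualBallEval_apply (x : F) (φ : DualBall F) : dualBallEval x φ = φ.toDual x := rfl

theorem norm_dualBallEval_le (x : F) : ‖dualBallEval x‖ ≤ ‖x‖ :=
  (ContinuousMap.norm_le _ (norm_nonneg _)).2 fun φ => φ.norm_toDual_apply_le x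

/-- By weak-* compactness the supremum is attained; Pietsch's argument needs an actual point of the
ball. -/
theorem exists_weakNorm_le (p : ℝ≥0∞) [Fact (1 ≤ p)] {n : ℕ} (x : Fin n → F) :
    ∃ φ : DualBall F, weakNorm p x ≤ strongNorm p fun i => φ.toDual (x i) := by
  have hc : Continuous fun φ : DualBall F => strongNorm p fun i => φ.toDual (x i) :=
    (continuous_strongNorm p).comp
      (continuous_pi fun i => DualBall.continuous_toDual_apply (x i))
  obtain ⟨φ, -, hφ⟩ := isCompact_univ.exists_isMaxOn Set.univ_nonempty hc.continuousOn
  refine ⟨φ, ciSup_le fun ψ => ?_⟩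
  exact hφ (Set.mem_univ (⟨(WeakDual.toStrongDual (𝕜 := ℝ) (E := F)).symm ψ.1, by
    simp⟩ : DualBall F))

/-- The Pietsch domination theorem. -/
theorem exists_pietsch_measure {p : ℝ≥0∞} [hp1 : Fact (1 ≤ p)] (hp : p ≠ ∞)
    {V : Type*} [AddCommGroup V] [Module ℝ V] {G : Type*} [NormedAddCommGroup G] [NormedSpace ℝ G]
    (d : V →ₗ[ℝ] F) (T : V →ₗ[ℝ] G) {C : ℝ} (hC : 0 ≤ C)
    (h : ∀ (n : ℕ) (v : Fin n → V),
      strongNorm p (fun i => T (v i)) ≤ C * weakNorm p fun i => d (v i)) :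
    ∃ (μ : Measure (DualBall F)) (_ : IsProbabilityMeasure μ), ∀ v,
      ‖T v‖ ≤ C * ‖ContinuousMap.toLp p μ ℝ (dualBallEval (d v))‖ := by
  have hp0 := toReal_pos_of_fact hp
  set r := p.toReal with hr
  -- A nonpositive integral of `f v` is the desired inequality raised to the power `r`, so a single
  -- measure must serve all `v`.
  let f : V → C(DualBall F, ℝ) := fun v =>
    ⟨fun φ => ‖T v‖ ^ r - C ^ r * ‖φ.toDual (d v)‖ ^ r, by
      have := DualBall.continuous_toDual_apply (d v)
      exact continuous_const.sub (continuous_const.mul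
        (this.norm.rpow_const fun _ => Or.inr hp0.le))⟩
  have hf : ∀ v φ, f v φ = ‖T v‖ ^ r - C ^ r * ‖φ.toDual (d v)‖ ^ r := fun _ _ => rfl
  have hf0 : f 0 = 0 := by
    ext φ
    simp [hf, Real.zero_rpow hp0.ne']
  have hfin : ∀ (n : ℕ) (v : Fin n → V), ∃ φ, ∑ i, f (v i) φ ≤ 0 := fun n v => by
    obtain ⟨φ, hφ⟩ := exists_weakNorm_le p fun i => d (v i)
    refine ⟨φ, ?_⟩
    have h1 := (h n v).trans (mul_le_mul_of_nonneg_left hφ hC)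
    have h2 := Real.rpow_le_rpow (strongNorm_nonneg _ _) h1 hp0.le
    rw [Real.mul_rpow hC (strongNorm_nonneg _ _), strongNorm_rpow hp0, strongNorm_rpow hp0] at h2
    simp only [hf]
    rw [Finset.sum_sub_distrib, ← Finset.mul_sum]
    exact sub_nonpos.2 h2
  obtain ⟨μ, hμ, hint⟩ := exists_isProbabilityMeasure_integral_nonpos
    (convex_convexHull ℝ (Set.range f))
    (subset_convexHull ℝ _ ⟨0, hf0⟩) fun g hg => by
      obtain ⟨ι, _, w, z, hw, -, hz, rfl⟩ := mem_convexHull_iff_exists_fintype.1 hg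
      choose v hv using hz
      -- Since `f` is homogeneous of degree `r`, the convex weight `w j` is absorbed by scaling `v
      -- j` with its `r`-th root.
      obtain ⟨φ, hφ⟩ := hfin _ fun i =>
        let j := (Fintype.equivFin ι).symm i
        w j ^ r⁻¹ • v j
      refine ⟨φ, le_trans (le_of_eq ?_) hφ⟩
      rw [Equiv.sum_comp (Fintype.equivFin ι).symm fun j => f (w j ^ r⁻¹ • v j) φ,
        ContinuousMap.sum_apply]
      refine Finset.sum_congr rfl fun j _ => ?_
      have hwj : ‖w j ^ r⁻¹‖ ^ r = w j := by
        rw [Real.norm_of_nonneg (Real.rpow_nonneg (hw j) _), ← Real.rpow_mul (hw j),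
          inv_mul_cancel₀ hp0.ne', Real.rpow_one]
      rw [ContinuousMap.smul_apply, ← hv, hf, hf, map_smul, map_smul, map_smul, norm_smul,
        norm_smul, Real.mul_rpow (norm_nonneg _) (norm_nonneg _),
        Real.mul_rpow (norm_nonneg _) (norm_nonneg _), hwj, smul_eq_mul]
      ring
  refine ⟨μ, hμ, fun v => ?_⟩
  have h1 := hint (f v) (subset_convexHull ℝ _ ⟨v, rfl⟩)
  have hcont : Continuous fun φ : DualBall F => ‖φ.toDual (d v)‖ ^ r :=
    (DualBall.continuous_toDual_apply (d v)).norm.rpow_const fun _ => Or.inr hp0.le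
  have hi : Integrable (fun φ : DualBall F => ‖φ.toDual (d v)‖ ^ r) μ :=
    hcont.integrable_of_hasCompactSupport (HasCompactSupport.of_compactSpace _)
  have h2 : ∫ φ, f v φ ∂μ = ‖T v‖ ^ r - C ^ r * ∫ φ, ‖φ.toDual (d v)‖ ^ r ∂μ := by
    simp only [hf]
    rw [integral_sub (integrable_const _) (hi.const_mul _), integral_const_mul]
    simp
  have h3 : ‖ContinuousMap.toLp p μ ℝ (dualBallEval (d v))‖ ^ r =
      ∫ φ, ‖φ.toDual (d v)‖ ^ r ∂μ := by
    rw [norm_Lp_rpow_eq_integral hp]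
    refine integral_congr_ae ?_
    filter_upwards [ContinuousMap.coeFn_toLp (p := p) (𝕜 := ℝ) μ (dualBallEval (d v))] with φ hφ
    rw [hφ, dualBallEval_apply]
  rw [← Real.rpow_le_rpow_iff (norm_nonneg _) (by positivity) hp0,
    Real.mul_rpow hC (norm_nonneg _), h3]
  linarith

end DualBall

/-! ### Summing maps into injective spaces are integral -/

section SummingToIntegral

variable {X : Type v} [MetricSpace X] {x₀ : X}
  {E : Type u} [NormedAddCommGroup E] [NormedSpace ℝ E]

theorem norm_delta_le (x y : X) : ‖delta x₀ x y‖ ≤ dist x y :=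
  ContinuousLinearMap.opNorm_le_bound _ dist_nonneg fun f => by
    rw [mul_comm]
    exact f.norm_sub_le x y

theorem delta_sub_delta (x y : X) : delta x₀ x x₀ - delta x₀ y x₀ = delta x₀ x y := by
  refine Subtype.ext (ContinuousLinearMap.ext fun f => ?_)
  change (f x - f x₀) - (f y - f x₀) = f x - f y
  ring

theorem IsStrictlySummingConst.abs_sum_le {p : ℝ≥0∞} {T : Lip0 x₀ E} {C : ℝ}
    (h : IsStrictlySummingConst p T C) (s : Finset X) (e : X → StrongDual ℝ E) :
    |∑ x ∈ s, e x (T x)| ≤ C * chevetSaphar p (∑ x ∈ s, delta x₀ x x₀ ⊗ₜ[ℝ] e x) := by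
  have := h.2 s.card (fun i => s.equivFin.symm i) (fun _ => x₀) (fun i => e (s.equivFin.symm i))
  simp only [lipChevetSaphar, T.apply_base, sub_zero] at this
  rw [Equiv.sum_comp s.equivFin.symm fun x : s => e x (T x),
    Equiv.sum_comp s.equivFin.symm fun x : s => delta x₀ (x : X) x₀ ⊗ₜ[ℝ] e x,
    Finset.sum_coe_sort s fun x => e x (T x),
    Finset.sum_coe_sort s fun x => delta x₀ x x₀ ⊗ₜ[ℝ] e x] at this
  exact this

/-- The linearization of a strictly Lipschitz `p`-summing map is `p`-summing on the linear span of
the point evaluations. -/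
theorem IsStrictlySummingConst.strongNorm_le {p : ℝ≥0∞} [hp1 : Fact (1 ≤ p)] (hp : p ≠ ∞)
    {T : Lip0 x₀ E} {C : ℝ} (h : IsStrictlySummingConst p T C) (n : ℕ) (v : Fin n → X →₀ ℝ) :
    strongNorm p (fun i => Finsupp.linearCombination ℝ T (v i)) ≤
      C * weakNorm p fun i => Finsupp.linearCombination ℝ (fun x => delta x₀ x x₀) (v i) := by
  classical
  have : Fact (1 ≤ ENNReal.conjExponent p) := ⟨one_le_conjExponent p⟩
  set T₀ := Finsupp.linearCombination ℝ (T : X → E)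
  set d := Finsupp.linearCombination ℝ fun x => delta x₀ x x₀
  obtain ⟨b, hb0, hb1, hb⟩ := exists_sum_mul_norm_eq_strongNorm hp fun i => T₀ (v i)
  choose ψ hψ1 hψ using fun i => exists_dual_vector'' ℝ (T₀ (v i))
  let s : Finset X := Finset.univ.biUnion fun i => (v i).support
  have hs : ∀ i, (v i).support ⊆ s := fun i =>
    Finset.subset_biUnion_of_mem (fun i => (v i).support) (Finset.mem_univ i)
  have hT : ∀ i, T₀ (v i) = ∑ x ∈ s, v i x • T x := fun i =>
    Finsupp.linearCombination_apply_of_mem_supported ℝ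
      ((Finsupp.mem_supported ℝ _).2 (by exact_mod_cast hs i))
  have hd : ∀ i, d (v i) = ∑ x ∈ s, v i x • delta x₀ x x₀ := fun i =>
    Finsupp.linearCombination_apply_of_mem_supported ℝ
      ((Finsupp.mem_supported ℝ _).2 (by exact_mod_cast hs i))
  -- With `b` extremal for Hölder and `ψ i` norming `T₀ (v i)`, these functionals reproduce the
  -- strong norm on the left, while the tensor regroups as a sum over `i` of `d (v i) ⊗ b i • ψ i`,
  -- whose second factors have conjugate norm at most 1.
  have key := h.abs_sum_le s fun x => ∑ i, v i x • b i • ψ i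
  have h1 : ∑ x ∈ s, (∑ i, v i x • b i • ψ i) (T x) = strongNorm p fun i => T₀ (v i) := by
    rw [← hb]
    simp only [_root_.sum_apply]
    rw [Finset.sum_comm]
    refine Finset.sum_congr rfl fun i _ => ?_
    have : ‖T₀ (v i)‖ = ψ i (T₀ (v i)) := by simpa using (hψ i).symm
    rw [this, hT i, map_sum, Finset.mul_sum]
    refine Finset.sum_congr rfl fun x _ => ?_
    simp only [_root_.smul_apply, map_smul, smul_eq_mul]
    ring
  have h2 : ∑ x ∈ s, delta x₀ x x₀ ⊗ₜ[ℝ] (∑ i, v i x • b i • ψ i) =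
      ∑ i, d (v i) ⊗ₜ[ℝ] (b i • ψ i) := by
    simp only [hd, TensorProduct.tmul_sum, TensorProduct.sum_tmul, TensorProduct.smul_tmul]
    exact Finset.sum_comm
  rw [h1, h2, abs_of_nonneg (strongNorm_nonneg _ _)] at key
  refine key.trans (mul_le_mul_of_nonneg_left ?_ h.1)
  refine (chevetSaphar_sum_tmul_le p _ _).trans
    (mul_le_of_le_one_right (weakNorm_nonneg _ _) (le_trans ?_ hb1))
  refine strongNorm_le_of_norm_le _ fun i => ?_
  rw [norm_smul]
  exact mul_le_of_le_one_right (norm_nonneg _) (hψ1 i)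

/-- Here `b` sends `x` to the evaluation at δ_(x,x₀) on the dual ball, which has Lipschitz constant
at most 1, and `A` is the extended operator followed by `K_E`. Working on `X →₀ ℝ` makes the
linearization defined without checking relations between the δ's. -/
theorem IsStrictlySummingConst.exists_factorization [CompleteSpace E] (hE : IsInjectiveBanach E)
    {p : ℝ≥0∞} [hp1 : Fact (1 ≤ p)] (hp : p ≠ ∞) {T : Lip0 x₀ E} {C : ℝ}
    (h : IsStrictlySummingConst p T C) :
    ∃ (Ω : Type v) (_ : MeasurableSpace Ω) (μ : Measure Ω) (_ : IsProbabilityMeasure μ)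
      (A : Lp ℝ p μ →L[ℝ] StrongDual ℝ (StrongDual ℝ E)) (b : Lip0 x₀ (Lp ℝ ∞ μ)),
      IsIntegralFactorization p T μ A b ∧ ‖b‖ * ‖A‖ ≤ C := by
  obtain ⟨μ, hμ, hdom⟩ := exists_pietsch_measure hp
    (Finsupp.linearCombination ℝ fun x => delta x₀ x x₀) (Finsupp.linearCombination ℝ (T : X → E))
    h.1 (h.strongNorm_le hp)
  obtain ⟨W, hW, hWn⟩ := hE.exists_extension
    ((ContinuousMap.toLp p μ ℝ).toLinearMap ∘ₗ dualBallEval ∘ₗ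
      Finsupp.linearCombination ℝ fun x => delta x₀ x x₀)
    (Finsupp.linearCombination ℝ (T : X → E)) h.1 hdom
  let ι : E →L[ℝ] StrongDual ℝ (StrongDual ℝ E) := NormedSpace.inclusionInDoubleDual ℝ E
  let L : C(DualBall (FreeBanach x₀), ℝ) →L[ℝ] Lp ℝ ∞ μ := ContinuousMap.toLp ∞ μ ℝ
  have hL : ‖L‖ ≤ 1 := (ContinuousMap.toLp_norm_le μ).trans (by simp)
  let b₀ : X → Lp ℝ ∞ μ := fun x => L (dualBallEval (delta x₀ x x₀))
  have hb₀ : ∀ x y, ‖b₀ x - b₀ y‖ ≤ 1 * dist x y := fun x y => by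
    rw [← map_sub, ← map_sub, delta_sub_delta]
    refine (L.le_of_opNorm_le hL _).trans ?_
    gcongr
    exact (norm_dualBallEval_le _).trans (norm_delta_le x y)
  have hbase : b₀ x₀ = 0 := by
    have : delta x₀ x₀ x₀ = 0 := by rw [← delta_sub_delta, sub_self]
    simp only [b₀, this, map_zero]
  let b : Lip0 x₀ (Lp ℝ ∞ μ) := Lip0.mk b₀ hbase
    ⟨1, LipschitzWith.of_dist_le_mul fun x y => by
      rw [dist_eq_norm]
      exact hb₀ x y⟩
  refine ⟨DualBall (FreeBanach x₀), inferInstance, μ, hμ, ι ∘L W, b, fun x => ?_, ?_⟩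
  · have hx := hW (Finsupp.single x 1)
    simp only [LinearMap.comp_apply, Finsupp.linearCombination_single, one_smul] at hx
    rw [ContinuousLinearMap.comp_apply, ← hx]
    rfl
  · have hb1 : ‖b‖ ≤ 1 := Lip0.norm_le zero_le_one hb₀
    have hA : ‖ι ∘L W‖ ≤ C := by
      refine (ι.opNorm_comp_le W).trans ?_
      calc ‖ι‖ * ‖W‖ ≤ 1 * C := mul_le_mul
            (NormedSpace.inclusionInDoubleDual_norm_le ℝ E) hWn (norm_nonneg _) zero_le_one
        _ = C := one_mul C
    calc ‖b‖ * ‖ι ∘L W‖ ≤ 1 * C := mul_le_mul hb1 hA (norm_nonneg _) zero_le_one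
      _ = C := one_mul C

end SummingToIntegral

end LipIdeal

theorem corollary3p9 {X : Type v} [MetricSpace X] (x₀ : X)
    {E : Type u} [NormedAddCommGroup E] [NormedSpace ℝ E] [CompleteSpace E]
    (hE : LipIdeal.IsInjectiveBanach E)
    (p : ℝ≥0∞) [Fact (1 ≤ p)] (hp : p ≠ ∞) :
    {T : LipIdeal.Lip0 x₀ E | LipIdeal.IsStrictlySumming p T} =
        {T : LipIdeal.Lip0 x₀ E | LipIdeal.IsStronglyIntegral p T} ∧
      ∀ T : LipIdeal.Lip0 x₀ E, LipIdeal.IsStrictlySumming p T →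
        LipIdeal.strictlySummingNorm p T = LipIdeal.stronglyIntegralNorm p T := by

  refine ⟨Set.ext fun T => ⟨?_, ?_⟩, fun T hT => le_antisymm ?_ ?_⟩
  · rintro ⟨C, hC⟩
    obtain ⟨Ω, mΩ, μ, hμ, A, b, h, -⟩ := hC.exists_factorization hE hp
    exact ⟨Ω, mΩ, μ, hμ, A, b, h⟩
  · rintro ⟨Ω, mΩ, μ, hμ, A, b, h⟩
    exact ⟨_, h.isStrictlySummingConst hp⟩
  · obtain ⟨C, hC⟩ := hT
    obtain ⟨Ω, mΩ, μ, hμ, A, b, h, -⟩ := hC.exists_factorization hE hp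
    -- The factorization at hand only shows that the infimum is over a nonempty set; the estimate
    -- concerns arbitrary ones.
    refine le_csInf ⟨_, Ω, mΩ, μ, hμ, A, b, h, rfl⟩ ?_
    rintro _ ⟨Ω', mΩ', μ', hμ', A', b', h', rfl⟩
    exact csInf_le ⟨0, fun _ hc => hc.1⟩ (h'.isStrictlySummingConst hp)
  · refine le_csInf hT fun C hC => ?_
    -- Every admissible `C` is matched by a factorization of cost at most `C`, without any loss.
    obtain ⟨Ω, mΩ, μ, hμ, A, b, h, hle⟩ := hC.exists_factorization hE hp
    refine le_trans (csInf_le ⟨0, ?_⟩ ⟨Ω, mΩ, μ, hμ, A, b, h, rfl⟩) hle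
    rintro _ ⟨Ω', mΩ', μ', hμ', A', b', -, rfl⟩
    exact mul_nonneg (norm_nonneg _) (norm_nonneg _)
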